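/- Let $X, Y$ be real Banach spaces and let $\mu_0$ be a convex (log-concave) Radon probability measure on $X$: a Borel probability measure, inner regular with respect to compact sets, with $\mu_0(\lambda A+(1-\lambda)B)\ge \mu_0(A)^{\lambda}\mu_0(B)^{1-\lambda}$ for all $0\le\lambda\le 1$ and all nonempty Borel sets $A,B\subseteq X$. Let $\alpha_1,\alpha_2\ge 0$ and let $\Phi:X\times Y\to\mathbb{R}$ satisfy, for every $r>0$: 1. there is $M\in\mathbb{R}$ with $\Phi(u;y)\ge M-\alpha_1\|u\|_X$ for all $u\in X$ and all $y$ with $\|y\|_Y<r$; 2. there is $K>0$ with $\Phi(u;y)\le K$ whenever $\max\{\|u\|_X,\|y\|_Y\}<r$; 3. there is $L>0$ with $|\Phi(u_1;y)-\Phi(u_2;y)|\le L\|u_1-u_2\|_X$ whenever $\max\{\|u_1\|_X,\|u_2\|_X,\|y\|_Y\}<r$; 4. there is $C\in\mathbb{R}$ with $|\Phi(u;y_1)-\Phi(u;y_2)|\le \exp(\alpha_2\|u\|_X+C)\,\|y_1-y_2\|_Y$ for all $u\in X$ whenever $\max\{\|y_1\|_Y,\|y_2\|_Y\}<r$. For $y\in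 Y$, the posterior $\mu^y$ is a Borel probability measure $\mu^y\ll\mu_0$ with $$\frac{d\mu^y}{d\mu_0}(u)=\frac{1}{Z(y)}\exp(-\Phi(u;y)),\qquad Z(y)=\int_X\exp(-\Phi(u;y))\,d\mu_0(u)\in(0,\infty).$$ Let $d_H(\mu_1,\mu_2)=\Big(\tfrac12\int_X\big(\sqrt{d\mu_1/d\Lambda}-\sqrt{d\mu_2/d\Lambda}\big)^2d\Lambda\Big)^{1/2}$ be the Hellinger distance, where $\Lambda$ is any $\sigma$-finite measure dominating $\mu_1$ and $\mu_2$. Then there is a $\kappa>0$ with $\int_X\exp(\kappa\|u\|_X)\,d\mu_0(u)<\infty$. Moreover, for every such $\kappa$ with $\kappa\ge\alpha_1+2\alpha_2$: (i) The inverse problem is Hellinger well-posed: for every $y\in Y$ there is exactly one posterior $\mu^y$; and for all $r,\epsilon>0$ there is $C>0$ such that $d_H(\mu^y,\mu^{y'})<\epsilon$ whenever $\|y\|_Y,\|y'\|_Y<r$ and $\|y-y'\|_Y<C$. (ii) Fix $y\in Y$ and $\alpha_3\ge 0$ with $\kappa\ge\alpha_1+2\alpha_3$. Let $\Phi_N:X\times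 Y\to\mathbb{R}$, $N\in\mathbb{N}$, be such that $\Phi_N(\cdot;y)$ is $\mu_0$-measurable for every $N$, the $\Phi_N$ satisfy conditions 1 (with the same $\alpha_1$) and 2 with constants $M,K$ independent of $N$, and for some $C\in\mathbb{R}$ and some $\psi(N)\to 0$ one has $|\Phi(u;y)-\Phi_N(u;y)|\le\exp(\alpha_3\|u\|_X+C)\,\psi(N)$ for all $u\in X$ and $N\in\mathbb{N}$. Then the posterior $\mu^y$ and the posteriors $\mu^y_N$ defined with $\Phi_N$ in place of $\Phi$ exist and are unique, and $d_H(\mu^y,\mu^y_N)\to 0$ as $N\to\infty$. (iii) If, for some $y\in Y$, the function $\Phi(\cdot;y)$ is convex on $X$, then $\mu^y$ is again a convex Radon probability measure. -/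

import Mathlib

open MeasureTheory Filter Topology Set
open scoped Pointwise ENNReal

noncomputable section

namespace BayesInverse

/-- A convex (log-concave) Radon probability measure on the Borel sets of `X`. `InnerRegular` is
inner approximation of every Borel set by compact sets. The sets `A`, `B` are nonempty because for
`l = 0` and `A = ∅` the inequality would read `0 ≥ μ B`; for `0 < l < 1` the case of an empty set is
trivial. The set `l • A + (1 - l) • B` need not be Borel and is measured by the outer measure of
`μ`; by inner regularity, this is the same as measuring it by the completion of `μ`. -/
structure IsConvexProbabilityMeasure {X : Type*} [NormedAddCommGroup X] [NormedSpace ℝ X]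
    [MeasurableSpace X] (μ : Measure X) : Prop where
  isProbability : IsProbabilityMeasure μ
  isInnerRegular : μ.InnerRegular
  convex_ineq : ∀ l : ℝ, 0 ≤ l → l ≤ 1 → ∀ A B : Set X, MeasurableSet A → MeasurableSet B →
    A.Nonempty → B.Nonempty → μ A ^ l * μ B ^ (1 - l) ≤ μ (l • A + (1 - l) • B)

/-- `∫ exp (κ ‖u‖) dμ(u) < ∞`. -/
def HasExpMoment {X : Type*} [NormedAddCommGroup X] [MeasurableSpace X]
    (μ : Measure X) (κ : ℝ) : Prop :=
  Integrable (fun u => Real.exp (κ * ‖u‖)) μ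

/-- The assumptions on the likelihood potential `Φ(u; y)`, with constants `α₁`, `α₂`. -/
structure LikelihoodAssumption {X Y : Type*} [NormedAddCommGroup X] [NormedAddCommGroup Y]
    (Φ : X → Y → ℝ) (α₁ α₂ : ℝ) : Prop where
  lower_bound : ∀ r : ℝ, 0 < r → ∃ M : ℝ, ∀ u : X, ∀ y : Y, ‖y‖ < r → M - α₁ * ‖u‖ ≤ Φ u y
  bounded_above : ∀ r : ℝ, 0 < r → ∃ K : ℝ, 0 < K ∧
    ∀ u : X, ∀ y : Y, max ‖u‖ ‖y‖ < r → Φ u y ≤ K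
  continuity_u : ∀ r : ℝ, 0 < r → ∃ L : ℝ, 0 < L ∧ ∀ u₁ u₂ : X, ∀ y : Y,
    max (max ‖u₁‖ ‖u₂‖) ‖y‖ < r → |Φ u₁ y - Φ u₂ y| ≤ L * ‖u₁ - u₂‖
  continuity_y : ∀ r : ℝ, 0 < r → ∃ C : ℝ, ∀ y₁ y₂ : Y, max ‖y₁‖ ‖y₂‖ < r → ∀ u : X,
    |Φ u y₁ - Φ u y₂| ≤ Real.exp (α₂ * ‖u‖ + C) * ‖y₁ - y₂‖

/-- The assumptions on approximations `Φ_N` of `Φ` at the data `y`: measurability (so that the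
approximate Bayes rule makes sense), the lower and upper bounds uniformly in `N`, and the
approximation bound with constant `α₃` and some rate `ψ(N) → 0`. -/
structure ApproximationAssumption {X Y : Type*} [NormedAddCommGroup X] [NormedAddCommGroup Y]
    [MeasurableSpace X] (μ₀ : Measure X) (Φ : X → Y → ℝ) (ΦN : ℕ → X → Y → ℝ) (y : Y)
    (α₁ α₃ : ℝ) : Prop where
  aemeasurable : ∀ N : ℕ, AEMeasurable (fun u => ΦN N u y) μ₀
  lower_bound : ∀ r : ℝ, 0 < r → ∃ M : ℝ, ∀ N : ℕ, ∀ u : X, ∀ y : Y, ‖y‖ < r →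
    M - α₁ * ‖u‖ ≤ ΦN N u y
  bounded_above : ∀ r : ℝ, 0 < r → ∃ K : ℝ, 0 < K ∧ ∀ N : ℕ, ∀ u : X, ∀ y : Y,
    max ‖u‖ ‖y‖ < r → ΦN N u y ≤ K
  approx : ∃ C : ℝ, ∃ ψ : ℕ → ℝ, Tendsto ψ atTop (𝓝 0) ∧
    ∀ N : ℕ, ∀ u : X, |Φ u y - ΦN N u y| ≤ Real.exp (α₃ * ‖u‖ + C) * ψ N

/-- The normalizing constant `Z(y) = ∫ exp (-Φ(u; y)) dμ₀(u)`. -/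
def normalizer {X Y : Type*} [MeasurableSpace X] (μ₀ : Measure X) (Φ : X → Y → ℝ) (y : Y) : ℝ :=
  ∫ u, Real.exp (-Φ u y) ∂μ₀

/-- `ν` is a posterior probability measure given by Bayes' rule: `ν ≪ μ₀` and
`dν/dμ₀ (u) = Z(y)⁻¹ exp (-Φ(u; y))`, with `0 < Z(y) < ∞`. -/
structure IsPosterior {X Y : Type*} [MeasurableSpace X] (μ₀ : Measure X) (Φ : X → Y → ℝ) (y : Y)
    (ν : Measure X) : Prop where
  isProbability : IsProbabilityMeasure ν
  absolutelyContinuous : ν ≪ μ₀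
  integrable : Integrable (fun u => Real.exp (-Φ u y)) μ₀
  normalizer_pos : 0 < normalizer μ₀ Φ y
  bayes_rule : ν.rnDeriv μ₀ =ᵐ[μ₀]
    fun u => ENNReal.ofReal ((normalizer μ₀ Φ y)⁻¹ * Real.exp (-Φ u y))

/-- The Hellinger distance of two finite measures, computed with the dominating measure
`Λ = μ₁ + μ₂` (its value does not depend on the choice of the dominating measure). -/
def hellingerDist {X : Type*} [MeasurableSpace X] (μ₁ μ₂ : Measure X) : ℝ :=
  Real.sqrt ((1 / 2) * ∫ u, (Real.sqrt (μ₁.rnDeriv (μ₁ + μ₂) u).toReal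
    - Real.sqrt (μ₂.rnDeriv (μ₁ + μ₂) u).toReal) ^ 2 ∂(μ₁ + μ₂))

/-- Hellinger well-posedness: for every `y` there is exactly one posterior, and the posterior
depends continuously on `y` in the Hellinger distance, uniformly on bounded sets of data. -/
structure IsWellPosed {X Y : Type*} [NormedAddCommGroup Y] [MeasurableSpace X]
    (μ₀ : Measure X) (Φ : X → Y → ℝ) : Prop where
  existsUnique : ∀ y : Y, ∃! ν : Measure X, IsPosterior μ₀ Φ y ν
  stable : ∀ r : ℝ, 0 < r → ∀ ε : ℝ, 0 < ε → ∃ C : ℝ, 0 < C ∧ ∀ y y' : Y,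
    ‖y‖ < r → ‖y'‖ < r → ‖y - y'‖ < C → ∀ ν ν' : Measure X,
      IsPosterior μ₀ Φ y ν → IsPosterior μ₀ Φ y' ν' → hellingerDist ν ν' < ε

/-- Consistency of the approximate posteriors at the data `y`: the posterior and all the
approximate posteriors exist and are unique, and the latter converge to the former in the
Hellinger distance. -/
structure IsConsistentApproximation {X Y : Type*} [MeasurableSpace X]
    (μ₀ : Measure X) (Φ : X → Y → ℝ) (ΦN : ℕ → X → Y → ℝ) (y : Y) : Prop where
  existsUnique : ∃! ν : Measure X, IsPosterior μ₀ Φ y ν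
  existsUnique_approx : ∀ N : ℕ, ∃! ν : Measure X, IsPosterior μ₀ (ΦN N) y ν
  tendsto : ∀ (ν : Measure X) (νN : ℕ → Measure X), IsPosterior μ₀ Φ y ν →
    (∀ N : ℕ, IsPosterior μ₀ (ΦN N) y (νN N)) →
    Tendsto (fun N => hellingerDist ν (νN N)) atTop (𝓝 0)

end BayesInverse

end

/-! Exponential moments follow from Borell's argument: if a ball B of radius R carries mass above
3/4, a suitable convex combination of a far tail with B lies outside B. Log-concavity then makes the
tails decay geometrically.

For (i) and (ii), the squared Hellinger distance is at most half the L¹ distance of the densities,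
and normalization costs at most a factor 2/Z. The lower bound on the potentials gives |exp(-Φ) -
exp(-Φ')| ≤ exp(α₁‖u‖ - M)|Φ - Φ'|, so one exponential moment of order α₁ + α controls everything,
where α is α₂ or α₃. The upper bound on a ball of positive mass keeps Z away from 0. Both stability
in the data and consistency are instances of `IsPosterior.hellingerDist_sq_le`.

For (iii), only the set inequality for μ₀ is available, and it must be upgraded to the density
exp(-φ). By the layer-cake formula, the integral of exp(-φ) over S is the integral over t of exp(-t)
μ₀({φ ≤ t} ∩ S). Convexity of φ and of μ₀ make these functions of t satisfy the hypothesis of the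
Prékopa–Leindler inequality on the real line. That inequality, proved from Brunn–Minkowski for
superlevel sets, gives the claim for compact sets; inner regularity extends it to Borel sets. -/

namespace BayesInverse

/-! ### Brunn–Minkowski and Prékopa–Leindler on the real line -/

/-- One-dimensional Brunn–Minkowski inequality for compact sets. -/
theorem volume_add_volume_le_of_isCompact {K L : Set ℝ} (hK : IsCompact K) (hL : IsCompact L)
    (hK' : K.Nonempty) (hL' : L.Nonempty) : volume K + volume L ≤ volume (K + L) := by
  -- With m = max K and l = min L, both l + K and m + L lie in K + L. The first is to the left of m
  -- + l and the second to the right, so they share only that point, which is removed.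
  obtain ⟨m, hm, hmK⟩ := hK.exists_isGreatest hK'
  obtain ⟨l, hl, hlL⟩ := hL.exists_isLeast hL'
  have h1 : volume ((fun x => l + x) '' K) = volume K := by
    rw [Set.image_add_left, measure_preimage_add]
  have h2 : volume ((fun x => m + x) '' L \ {m + l}) = volume L := by
    rw [measure_sdiff_null (measure_singleton _), Set.image_add_left, measure_preimage_add]
  have hd : Disjoint ((fun x => l + x) '' K) ((fun x => m + x) '' L \ {m + l}) := by
    rw [Set.disjoint_left]
    rintro _ ⟨x, hx, rfl⟩ ⟨⟨z, hz, hzx⟩, hne⟩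
    have := hmK hx
    have := hlL hz
    simp only at hzx
    exact hne (by simp only [mem_singleton_iff]; linarith)
  have hmeas : MeasurableSet ((fun x => m + x) '' L \ {m + l}) :=
    (hL.image (by fun_prop)).measurableSet.diff (measurableSet_singleton _)
  rw [← h1, ← h2, ← measure_union hd hmeas]
  refine measure_mono ?_
  rintro _ (⟨x, hx, rfl⟩ | ⟨⟨x, hx, rfl⟩, -⟩)
  · exact ⟨x, hx, l, hl, add_comm _ _⟩
  · exact ⟨m, hm, x, hx, rfl⟩

/-- One-dimensional Brunn–Minkowski inequality. -/
theorem volume_add_volume_le {A B : Set ℝ} (hA : MeasurableSet A) (hB : MeasurableSet B)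
    (hA' : A.Nonempty) (hB' : B.Nonempty) : volume A + volume B ≤ volume (A + B) := by
  obtain ⟨a, ha⟩ := hA'
  obtain ⟨b, hb⟩ := hB'
  rw [hA.measure_eq_iSup_isCompact, hB.measure_eq_iSup_isCompact]
  simp only [iSup_and']
  refine ENNReal.biSup_add_biSup_le' ⟨∅, empty_subset _, isCompact_empty⟩
    ⟨∅, empty_subset _, isCompact_empty⟩ ?_
  rintro K ⟨hKA, hK⟩ L ⟨hLB, hL⟩
  -- The approximating compact sets may be empty; adding a point of A and of B makes them nonempty.
  calc volume K + volume L ≤ volume (insert a K) + volume (insert b L) :=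
        add_le_add (measure_mono (subset_insert _ _)) (measure_mono (subset_insert _ _))
    _ ≤ volume (insert a K + insert b L) :=
        volume_add_volume_le_of_isCompact (hK.insert a) (hL.insert b)
          (insert_nonempty _ _) (insert_nonempty _ _)
    _ ≤ volume (A + B) := measure_mono
        (Set.add_subset_add (insert_subset ha hKA) (insert_subset hb hLB))

/-- Weighted inequality of arithmetic and geometric means in `ℝ≥0∞`. -/
theorem ennreal_rpow_mul_rpow_le {l : ℝ} (h0 : 0 < l) (h1 : l < 1) (x y : ℝ≥0∞) :
    x ^ l * y ^ (1 - l) ≤ ENNReal.ofReal l * x + ENNReal.ofReal (1 - l) * y := by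
  have h1' : 0 < 1 - l := by linarith
  by_cases hx : x = ∞
  · have : ENNReal.ofReal l * x = ∞ := by
      rw [hx]; exact ENNReal.mul_top (by simpa using h0)
    rw [this]; simp
  by_cases hy : y = ∞
  · have : ENNReal.ofReal (1 - l) * y = ∞ := by
      rw [hy]; exact ENNReal.mul_top (by simpa using h1)
    rw [this]; simp
  lift x to NNReal using hx
  lift y to NNReal using hy
  have := Real.geom_mean_le_arith_mean2_weighted h0.le h1'.le x.coe_nonneg y.coe_nonneg (by ring)
  rw [← ENNReal.ofReal_coe_nnreal, ← ENNReal.ofReal_coe_nnreal,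
    ENNReal.ofReal_rpow_of_nonneg x.coe_nonneg h0.le, ENNReal.ofReal_rpow_of_nonneg y.coe_nonneg h1'.le,
    ← ENNReal.ofReal_mul (by positivity), ← ENNReal.ofReal_mul h0.le, ← ENNReal.ofReal_mul h1'.le,
    ← ENNReal.ofReal_add (mul_nonneg h0.le x.coe_nonneg) (mul_nonneg h1'.le y.coe_nonneg)]
  exact ENNReal.ofReal_le_ofReal this

/-- The arithmetic form of the Prékopa–Leindler inequality for functions with supremum `1`. -/
theorem lintegral_add_lintegral_le_of_sup_eq_one {f g h : ℝ → ℝ} (hf : Measurable f)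
    (hg : Measurable g) (hh : Measurable h) (hf0 : ∀ x, 0 ≤ f x) (hg0 : ∀ x, 0 ≤ g x)
    (hh0 : ∀ x, 0 ≤ h x) (hf1 : IsLUB (range f) 1) (hg1 : IsLUB (range g) 1)
    {l : ℝ} (h0 : 0 < l) (h1 : l < 1)
    (H : ∀ s t, f s ^ l * g t ^ (1 - l) ≤ h (l * s + (1 - l) * t)) :
    (ENNReal.ofReal l * ∫⁻ x, ENNReal.ofReal (f x)) +
      (ENNReal.ofReal (1 - l) * ∫⁻ x, ENNReal.ofReal (g x)) ≤ ∫⁻ x, ENNReal.ofReal (h x) := by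
  have h1' : 0 < 1 - l := by linarith
  have key : ∀ k : ℝ → ℝ, Measurable k → (∀ x, 0 ≤ k x) →
      ∫⁻ x, ENNReal.ofReal (k x) = ∫⁻ t in Ioi 0, volume {x | t < k x} := fun k hk hk0 =>
    lintegral_eq_lintegral_meas_lt volume (ae_of_all _ hk0) hk.aemeasurable
  have hmeas : ∀ k : ℝ → ℝ, Measurable fun t : ℝ => volume {x | t < k x} := fun k =>
    Antitone.measurable fun s t hst => measure_mono fun x hx => lt_of_le_of_lt hst hx
  rw [key f hf hf0, key g hg hg0, key h hh hh0, ← lintegral_const_mul _ (hmeas f),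
    ← lintegral_const_mul _ (hmeas g), ← lintegral_add_left ((hmeas f).const_mul _)]
  refine setLIntegral_mono' measurableSet_Ioi fun t ht => ?_
  have ht0 : (0 : ℝ) < t := ht
  -- The common supremum 1 makes the superlevel sets of f and g nonempty for the same t < 1, as
  -- Brunn–Minkowski requires; for t ≥ 1 both are empty.
  by_cases ht1 : t < 1
  · obtain ⟨_, ⟨x, rfl⟩, hx, -⟩ := hf1.exists_between ht1
    obtain ⟨_, ⟨z, rfl⟩, hz, -⟩ := hg1.exists_between ht1
    have hA : MeasurableSet {x | t < f x} := measurableSet_lt measurable_const hf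
    have hB : MeasurableSet {x | t < g x} := measurableSet_lt measurable_const hg
    have e1 : volume (l • {x | t < f x}) = ENNReal.ofReal l * volume {x | t < f x} := by
      simpa using Measure.addHaar_smul_of_nonneg volume h0.le {x | t < f x}
    have e2 : volume ((1 - l) • {x | t < g x}) =
        ENNReal.ofReal (1 - l) * volume {x | t < g x} := by
      simpa using Measure.addHaar_smul_of_nonneg volume h1'.le {x | t < g x}
    rw [← e1, ← e2]
    refine (volume_add_volume_le (hA.const_smul₀ l) (hB.const_smul₀ _)
      (Set.Nonempty.smul_set ⟨x, hx⟩) (Set.Nonempty.smul_set ⟨z, hz⟩)).trans (measure_mono ?_)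
    rintro _ ⟨_, ⟨s, hs, rfl⟩, _, ⟨u, hu, rfl⟩, rfl⟩
    have hs : t < f s := hs
    have hu : t < g u := hu
    refine lt_of_lt_of_le ?_ (H s u)
    calc t = t ^ l * t ^ (1 - l) := by rw [← Real.rpow_add ht0]; simp
      _ < f s ^ l * g u ^ (1 - l) := by
        have := Real.rpow_lt_rpow ht0.le hs h0
        have := Real.rpow_lt_rpow ht0.le hu h1'
        gcongr
  · have e : ∀ k : ℝ → ℝ, IsLUB (range k) 1 → volume {x | t < k x} = 0 := fun k hk => by
      have : {x | t < k x} = ∅ := by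
        ext x
        have := hk.1 (mem_range_self x)
        simp only [mem_ofPred_eq, mem_empty_iff_false, iff_false, not_lt]
        linarith
      rw [this, measure_empty]
    rw [e f hf1, e g hg1]
    simp

/-- One-dimensional Prékopa–Leindler inequality for bounded functions. -/
theorem prekopa_leindler_real {f g h : ℝ → ℝ} (hf : Measurable f)
    (hg : Measurable g) (hh : Measurable h) (hf0 : ∀ x, 0 ≤ f x) (hg0 : ∀ x, 0 ≤ g x)
    (hh0 : ∀ x, 0 ≤ h x) (hf1 : BddAbove (range f)) (hg1 : BddAbove (range g))
    {l : ℝ} (h0 : 0 < l) (h1 : l < 1)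
    (H : ∀ s t, f s ^ l * g t ^ (1 - l) ≤ h (l * s + (1 - l) * t)) :
    (∫⁻ x, ENNReal.ofReal (f x)) ^ l * (∫⁻ x, ENNReal.ofReal (g x)) ^ (1 - l) ≤
      ∫⁻ x, ENNReal.ofReal (h x) := by
  have h1' : 0 < 1 - l := by linarith
  have sup_pos : ∀ k : ℝ → ℝ, (∀ x, 0 ≤ k x) → BddAbove (range k) →
      ∫⁻ x, ENNReal.ofReal (k x) ≠ 0 → 0 < sSup (range k) := by
    intro k hk hb hi
    by_contra! hle
    refine hi ?_
    have : ∀ x, ENNReal.ofReal (k x) = 0 := fun x =>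
      ENNReal.ofReal_eq_zero.2 ((le_csSup hb (mem_range_self x)).trans hle)
    simp [this]
  by_cases hfi : ∫⁻ x, ENNReal.ofReal (f x) = 0
  · rw [hfi, ENNReal.zero_rpow_of_pos h0, zero_mul]; exact zero_le
  by_cases hgi : ∫⁻ x, ENNReal.ofReal (g x) = 0
  · rw [hgi, ENNReal.zero_rpow_of_pos h1', mul_zero]; exact zero_le
  have ha := sup_pos f hf0 hf1 hfi
  have hb := sup_pos g hg0 hg1 hgi
  set a := sSup (range f)
  set b := sSup (range g)
  have hlub : ∀ k : ℝ → ℝ, BddAbove (range k) → 0 < sSup (range k) →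
      IsLUB (range fun x => (sSup (range k))⁻¹ * k x) 1 := by
    intro k hk hpos
    have := (isLUB_csSup (range_nonempty k) hk).mul_left (inv_nonneg.2 hpos.le)
    rw [inv_mul_cancel₀ hpos.ne', ← range_comp] at this
    exact this
  have hcpos : 0 < a ^ l * b ^ (1 - l) := by positivity
  -- The hypothesis is homogeneous: dividing f and g by their suprema a and b divides h by a^l
  -- b^(1-l).
  have main := lintegral_add_lintegral_le_of_sup_eq_one (hf.const_mul a⁻¹) (hg.const_mul b⁻¹)
    (hh.const_mul (a ^ l * b ^ (1 - l))⁻¹) (fun x => mul_nonneg (inv_nonneg.2 ha.le) (hf0 x))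
    (fun x => mul_nonneg (inv_nonneg.2 hb.le) (hg0 x))
    (fun x => mul_nonneg (inv_nonneg.2 hcpos.le) (hh0 x)) (hlub f hf1 ha) (hlub g hg1 hb) h0 h1 ?_
  swap
  · intro s t
    rw [Real.mul_rpow (inv_nonneg.2 ha.le) (hf0 s), Real.mul_rpow (inv_nonneg.2 hb.le) (hg0 t),
      Real.inv_rpow ha.le, Real.inv_rpow hb.le, mul_mul_mul_comm, ← mul_inv]
    exact mul_le_mul_of_nonneg_left (H s t) (inv_nonneg.2 hcpos.le)
  have scale : ∀ (k : ℝ → ℝ) (c : ℝ), Measurable k → 0 < c →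
      ∫⁻ x, ENNReal.ofReal (k x) = ENNReal.ofReal c * ∫⁻ x, ENNReal.ofReal (c⁻¹ * k x) := by
    intro k c hk hc
    rw [← lintegral_const_mul _ (hk.const_mul _).ennreal_ofReal]
    congr 1
    ext x
    rw [← ENNReal.ofReal_mul hc.le, mul_inv_cancel_left₀ hc.ne']
  rw [scale f a hf ha, scale g b hg hb, scale h _ hh hcpos,
    ENNReal.mul_rpow_of_nonneg _ _ h0.le, ENNReal.mul_rpow_of_nonneg _ _ h1'.le,
    ENNReal.ofReal_rpow_of_pos ha, ENNReal.ofReal_rpow_of_pos hb, mul_mul_mul_comm,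
    ← ENNReal.ofReal_mul (by positivity)]
  gcongr
  exact (ennreal_rpow_mul_rpow_le h0 h1 _ _).trans main

/-! ### Layer-cake formula and inner regularity -/

/-- Layer-cake formula for `exp (-φ)` in terms of the sublevel sets of `φ`. -/
theorem lintegral_exp_neg_eq_lintegral_sublevel {X : Type*} [MeasurableSpace X] (μ : Measure X)
    [SFinite μ] {φ : X → ℝ} (hφ : Measurable φ) :
    ∫⁻ u, ENNReal.ofReal (Real.exp (-φ u)) ∂μ =
      ∫⁻ t : ℝ, ENNReal.ofReal (Real.exp (-t)) * μ {u | φ u ≤ t} := by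
  have hset : MeasurableSet {p : X × ℝ | φ p.1 ≤ p.2} :=
    measurableSet_le (hφ.comp measurable_fst) measurable_snd
  have hexp : Measurable fun t : ℝ => ENNReal.ofReal (Real.exp (-t)) := by fun_prop
  -- Here exp(-φ u) is the integral of exp(-t) over t ≥ φ u; Tonelli then exchanges the integrals.
  have hin : ∀ u, ENNReal.ofReal (Real.exp (-φ u)) =
      ∫⁻ t : ℝ, {p : X × ℝ | φ p.1 ≤ p.2}.indicator
        (fun p => ENNReal.ofReal (Real.exp (-p.2))) (u, t) := by
    intro u
    rw [← integral_exp_neg_Ioi (φ u), ofReal_integral_eq_lintegral_ofReal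
      (integrableOn_exp_neg_Ioi _) (ae_of_all _ fun t => (Real.exp_pos _).le),
      ← setLIntegral_congr Ioi_ae_eq_Ici.symm, ← lintegral_indicator measurableSet_Ici]
    rfl
  simp_rw [hin]
  rw [lintegral_lintegral_swap]
  · refine lintegral_congr fun t => ?_
    have : (fun u => {p : X × ℝ | φ p.1 ≤ p.2}.indicator
        (fun p => ENNReal.ofReal (Real.exp (-p.2))) (u, t)) =
        {u | φ u ≤ t}.indicator fun _ => ENNReal.ofReal (Real.exp (-t)) := rfl
    rw [this, lintegral_indicator_const (measurableSet_le hφ measurable_const)]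
  · exact ((hexp.comp measurable_snd).indicator hset).aemeasurable

/-- A finite measure with a density with respect to an inner regular measure is inner regular. -/
theorem innerRegular_of_absolutelyContinuous {X : Type*} [TopologicalSpace X] [T2Space X]
    [MeasurableSpace X] [BorelSpace X] {μ ν : Measure X} [IsFiniteMeasure μ] [IsFiniteMeasure ν]
    [μ.InnerRegular] (h : ν ≪ μ) : ν.InnerRegular := by
  refine ⟨fun U hU r hr => ?_⟩
  -- Absolute continuity of the integral: a compact K with μ(U \ K) < δ loses less than ν U - r of
  -- the ν-mass.
  obtain ⟨δ, hδ, H⟩ := exists_pos_setLIntegral_lt_of_measure_lt (μ := μ) (f := ν.rnDeriv μ)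
    (Measure.lintegral_rnDeriv_lt_top _ _).ne (tsub_pos_of_lt hr).ne'
  obtain ⟨K, hKU, hK, hlt⟩ := hU.exists_isCompact_sdiff_lt (measure_ne_top μ U) hδ.ne'
  refine ⟨K, hKU, hK, ?_⟩
  have hlt' := H _ hlt
  rw [Measure.setLIntegral_rnDeriv h] at hlt'
  have hadd : ν U ≤ ν (U \ K) + ν K := by
    rw [add_comm]; exact (measure_mono (by simp)).trans (measure_union_le K (U \ K))
  by_contra! hle
  refine absurd hadd (not_le.2 ?_)
  calc ν (U \ K) + ν K ≤ ν (U \ K) + r := by gcongr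
    _ < ν U - r + r := ENNReal.add_lt_add_right (hr.ne_top) hlt'
    _ = ν U := tsub_add_cancel_of_le hr.le

/-! ### Log-concavity is preserved by convex potentials -/

section Convex

variable {X : Type*} [NormedAddCommGroup X] [NormedSpace ℝ X] [MeasurableSpace X] [BorelSpace X]

/-- Functional form of the convexity inequality for the density `exp (-φ)` on compact sets. -/
theorem IsConvexProbabilityMeasure.setLIntegral_exp_neg_le {μ : Measure X}
    (hμ : IsConvexProbabilityMeasure μ) {φ : X → ℝ} (hφ : Continuous φ)
    (hc : ConvexOn ℝ univ φ) {K L : Set X} (hK : IsCompact K) (hL : IsCompact L)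
    {l : ℝ} (h0 : 0 < l) (h1 : l < 1) :
    (∫⁻ u in K, ENNReal.ofReal (Real.exp (-φ u)) ∂μ) ^ l *
      (∫⁻ u in L, ENNReal.ofReal (Real.exp (-φ u)) ∂μ) ^ (1 - l) ≤
      ∫⁻ u in l • K + (1 - l) • L, ENNReal.ofReal (Real.exp (-φ u)) ∂μ := by
  have h1' : 0 < 1 - l := by linarith
  have := hμ.isProbability
  let F : Set X → ℝ → ℝ := fun S t => Real.exp (-t) * μ.real ({u | φ u ≤ t} ∩ S)
  have hF0 : ∀ S t, 0 ≤ F S t := fun S t => by positivity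
  have hFm : ∀ S, Measurable (F S) := fun S => by
    refine Measurable.mul (by fun_prop) (Monotone.measurable fun s t hst => ?_)
    exact measureReal_mono (inter_subset_inter_left _ fun u hu => le_trans hu hst)
  -- Compactness enters here: φ ≥ m on S, so F S vanishes below m and is at most exp(-m) above it.
  have hFb : ∀ S, IsCompact S → BddAbove (range (F S)) := by
    intro S hS
    obtain ⟨m, hm⟩ := (hS.image hφ).bddBelow
    refine ⟨Real.exp (-m), ?_⟩
    rintro _ ⟨t, rfl⟩
    rcases eq_empty_or_nonempty ({u | φ u ≤ t} ∩ S) with he | ⟨u, hu, huS⟩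
    · simp only [F, he, measureReal_empty, mul_zero]
      positivity
    · have hmt : m ≤ t := (hm (mem_image_of_mem φ huS)).trans hu
      calc F S t ≤ Real.exp (-t) * 1 := by
            exact mul_le_mul_of_nonneg_left measureReal_le_one (Real.exp_pos _).le
        _ ≤ Real.exp (-m) := by rw [mul_one]; gcongr
  have hlev : ∀ t, MeasurableSet {u | φ u ≤ t} := fun t =>
    (isClosed_le hφ continuous_const).measurableSet
  have hFi : ∀ S, ∫⁻ u in S, ENNReal.ofReal (Real.exp (-φ u)) ∂μ =
      ∫⁻ t, ENNReal.ofReal (F S t) := by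
    intro S
    rw [lintegral_exp_neg_eq_lintegral_sublevel _ hφ.measurable]
    refine lintegral_congr fun t => ?_
    rw [Measure.restrict_apply (hlev t), ENNReal.ofReal_mul (Real.exp_pos _).le,
      ofReal_measureReal]
  rw [hFi, hFi, hFi]
  refine prekopa_leindler_real (hFm _) (hFm _) (hFm _) (hF0 _) (hF0 _) (hF0 _) (hFb _ hK)
    (hFb _ hL) h0 h1 fun s t => ?_
  have hexp : Real.exp (-(l * s + (1 - l) * t)) =
      Real.exp (-s) ^ l * Real.exp (-t) ^ (1 - l) := by
    rw [← Real.exp_mul, ← Real.exp_mul, ← Real.exp_add]; congr 1; ring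
  have hnn : 0 ≤ Real.exp (-s) ^ l * Real.exp (-t) ^ (1 - l) := by positivity
  simp only [F]
  rw [Real.mul_rpow (by positivity) (by positivity), Real.mul_rpow (by positivity) (by positivity),
    mul_mul_mul_comm, hexp]
  refine mul_le_mul_of_nonneg_left ?_ hnn
  rcases eq_empty_or_nonempty ({u | φ u ≤ s} ∩ K) with he | hA
  · rw [he, measureReal_empty, Real.zero_rpow h0.ne', zero_mul]; positivity
  rcases eq_empty_or_nonempty ({u | φ u ≤ t} ∩ L) with he | hB
  · rw [he, measureReal_empty, Real.zero_rpow h1'.ne', mul_zero]; positivity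
  have hci := hμ.convex_ineq l h0.le h1.le _ _ ((hlev s).inter hK.measurableSet)
    ((hlev t).inter hL.measurableSet) hA hB
  simp only [measureReal_def]
  rw [ENNReal.toReal_rpow, ENNReal.toReal_rpow, ← ENNReal.toReal_mul]
  refine ENNReal.toReal_mono (measure_ne_top _ _) (hci.trans (measure_mono ?_))
  rintro _ ⟨_, ⟨x, ⟨hx, hxK⟩, rfl⟩, _, ⟨z, ⟨hz, hzL⟩, rfl⟩, rfl⟩
  refine ⟨?_, add_mem_add (smul_mem_smul_set hxK) (smul_mem_smul_set hzL)⟩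
  have hx : φ x ≤ s := hx
  have hz : φ z ≤ t := hz
  refine (hc.2 (mem_univ x) (mem_univ z) h0.le h1'.le (by ring)).trans ?_
  simp only [smul_eq_mul]
  gcongr

/-- A probability measure with density proportional to `exp (-φ)`, `φ` convex and continuous, with
respect to a convex measure is convex. -/
theorem IsConvexProbabilityMeasure.of_withDensity {μ ν : Measure X}
    (hμ : IsConvexProbabilityMeasure μ) (hν : IsProbabilityMeasure ν) {φ : X → ℝ}
    (hφ : Continuous φ) (hc : ConvexOn ℝ univ φ) {c : ℝ} (hc0 : 0 ≤ c)
    (hd : ν = μ.withDensity fun u => ENNReal.ofReal (c * Real.exp (-φ u))) :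
    IsConvexProbabilityMeasure ν := by
  have := hμ.isProbability
  have := hμ.isInnerRegular
  have hreg : ν.InnerRegular :=
    innerRegular_of_absolutelyContinuous (hd ▸ withDensity_absolutelyContinuous μ _)
  refine ⟨hν, hreg, fun l h0 h1 A B hA hB hA' hB' => ?_⟩
  rcases h0.eq_or_lt with rfl | h0
  · simp [zero_smul_set hA']
  rcases h1.eq_or_lt with rfl | h1
  · simp [zero_smul_set hB']
  have h1' : 0 < 1 - l := by linarith
  have hset : ∀ S, MeasurableSet S → ν S =
      ENNReal.ofReal c * ∫⁻ u in S, ENNReal.ofReal (Real.exp (-φ u)) ∂μ := by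
    intro S hS
    rw [hd, withDensity_apply _ hS, ← lintegral_const_mul _ (by fun_prop)]
    simp_rw [ENNReal.ofReal_mul hc0]
  -- For compact K and L the set l • K + (1 - l) • L is compact, hence measurable, so the density
  -- formula applies to it.
  have hcomp : ∀ K L, IsCompact K → IsCompact L →
      ν K ^ l * ν L ^ (1 - l) ≤ ν (l • K + (1 - l) • L) := by
    intro K L hK hL
    rw [hset K hK.measurableSet, hset L hL.measurableSet,
      hset _ ((hK.smul l).add (hL.smul (1 - l))).measurableSet,
      ENNReal.mul_rpow_of_nonneg _ _ h0.le, ENNReal.mul_rpow_of_nonneg _ _ h1'.le,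
      mul_mul_mul_comm]
    refine mul_le_mul' (le_of_eq ?_) (hμ.setLIntegral_exp_neg_le hφ hc hK hL h0 h1)
    rw [← ENNReal.rpow_add_of_nonneg _ _ h0.le h1'.le]
    simp
  have hsup : ∀ S, MeasurableSet S → ∀ p : ℝ, 0 < p →
      ν S ^ p = ⨆ K : {K // K ⊆ S ∧ IsCompact K}, ν K ^ p := by
    intro S hS p hp
    rw [hS.measure_eq_iSup_isCompact]
    simp only [iSup_and', iSup_subtype']
    exact (ENNReal.orderIsoRpow p hp).map_iSup _
  rw [hsup A hA l h0, hsup B hB _ h1', ENNReal.iSup_mul]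
  refine iSup_le fun K => ?_
  rw [ENNReal.mul_iSup]
  refine iSup_le fun L => (hcomp K L K.2.2 L.2.2).trans (measure_mono ?_)
  exact Set.add_subset_add (smul_set_mono K.2.1) (smul_set_mono L.2.1)

end Convex

/-! ### Exponential tails of convex measures -/

section ExpMoment

variable {X : Type*} [NormedAddCommGroup X] [MeasurableSpace X]

/-- A probability measure gives mass close to one to some ball. -/
theorem exists_lt_measureReal_ball (μ : Measure X) [IsProbabilityMeasure μ] {c : ℝ} (hc : c < 1) :
    ∃ R : ℝ, 0 < R ∧ c < μ.real (Metric.ball 0 R) := by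
  have hmono : Monotone fun n : ℕ => Metric.ball (0 : X) n := fun m n hmn =>
    Metric.ball_subset_ball (by exact_mod_cast hmn)
  have ht := tendsto_measure_iUnion_atTop (μ := μ) hmono
  rw [Metric.iUnion_ball_nat, measure_univ] at ht
  have ht' := (ENNReal.tendsto_toReal ENNReal.one_ne_top).comp ht
  obtain ⟨n, hn, hn0⟩ := ((ht'.eventually (lt_mem_nhds (by simpa using hc))).and
    (eventually_gt_atTop 0)).exists
  exact ⟨n, by exact_mod_cast hn0, hn⟩

variable [NormedSpace ℝ X] [BorelSpace X]

/-- Exponential decay of the tails of a convex measure. -/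
theorem IsConvexProbabilityMeasure.measureReal_tail_le {μ : Measure X}
    (hμ : IsConvexProbabilityMeasure μ) {R : ℝ}
    (hR' : 3 / 4 < μ.real (Metric.ball 0 R)) (n : ℕ) :
    μ.real {u | (2 * n - 1) * R ≤ ‖u‖} ≤ (1 / 3) ^ n := by
  have := hμ.isProbability
  rcases n with _ | n
  · simp
  set A := {u : X | (2 * ((n + 1 : ℕ) : ℝ) - 1) * R ≤ ‖u‖} with hA
  set B := Metric.ball (0 : X) R with hB
  have hAm : MeasurableSet A := measurableSet_le measurable_const measurable_norm
  have hBm : MeasurableSet B := Metric.isOpen_ball.measurableSet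
  rcases A.eq_empty_or_nonempty with he | hA'
  · rw [he, measureReal_empty]; positivity
  have hB' : B.Nonempty := by
    rw [nonempty_iff_ne_empty]; rintro he; rw [he, measureReal_empty] at hR'; linarith
  -- This weight gives l(2n + 1) = 2 - l, so ‖l x + (1 - l) z‖ ≥ (2 - l)R - (1 - l)R = R for x in
  -- the tail A and z in B.
  set l : ℝ := 1 / (n + 1) with hl
  have hl0 : 0 < l := by positivity
  have hl1 : l ≤ 1 := by rw [hl, div_le_one (by positivity)]; linarith [n.cast_nonneg (α := ℝ)]
  have hci := hμ.convex_ineq l hl0.le hl1 A B hAm hBm hA' hB'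
  have hsub : l • A + (1 - l) • B ⊆ Bᶜ := by
    rintro _ ⟨_, ⟨x, hx, rfl⟩, _, ⟨z, hz, rfl⟩, rfl⟩ hmem
    simp only [hA, mem_ofPred_eq] at hx
    simp only [hB, mem_ball_zero_iff] at hz hmem
    have hx2 : (2 - l) * R ≤ ‖l • x‖ := by
      rw [norm_smul, Real.norm_of_nonneg hl0.le]
      calc (2 - l) * R = l * ((2 * ((n + 1 : ℕ) : ℝ) - 1) * R) := by
            rw [hl]; push_cast; field_simp
        _ ≤ _ := by gcongr
    have hz2 : ‖(1 - l) • z‖ ≤ (1 - l) * R := by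
      rw [norm_smul, Real.norm_of_nonneg (by linarith)]
      have : 0 ≤ 1 - l := by linarith
      gcongr
    have := norm_sub_le (l • x + (1 - l) • z) ((1 - l) • z)
    rw [add_sub_cancel_right] at this
    linarith
  have hci' : μ.real A ^ l * μ.real B ^ (1 - l) ≤ 1 - μ.real B := by
    rw [← probReal_compl_eq_one_sub hBm]
    simp only [measureReal_def]
    rw [ENNReal.toReal_rpow, ENNReal.toReal_rpow, ← ENNReal.toReal_mul]
    exact ENNReal.toReal_mono (measure_ne_top _ _) (hci.trans (measure_mono hsub))
  have hBpow : μ.real B ≤ μ.real B ^ (1 - l) := by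
    simpa using Real.rpow_le_rpow_of_exponent_ge (by linarith) (measureReal_le_one (μ := μ) (s := B))
      (by linarith : 1 - l ≤ 1)
  have hpow0 : 0 ≤ μ.real A ^ l := by positivity
  -- The left side times 3/4 is at most 1 - μ(B) < 1/4.
  have hpow : μ.real A ^ l ≤ 1 / 3 := by
    have : μ.real A ^ l * (3 / 4) ≤ μ.real A ^ l * μ.real B ^ (1 - l) := by gcongr; linarith
    linarith
  calc μ.real A = (μ.real A ^ l) ^ (n + 1) := by
        rw [← Real.rpow_natCast, ← Real.rpow_mul measureReal_nonneg, hl]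
        push_cast
        rw [one_div_mul_cancel (by positivity), Real.rpow_one]
    _ ≤ (1 / 3) ^ (n + 1) := by gcongr

/-- A convex measure has exponential moments. -/
theorem IsConvexProbabilityMeasure.exists_hasExpMoment {μ : Measure X}
    (hμ : IsConvexProbabilityMeasure μ) : ∃ κ : ℝ, 0 < κ ∧ HasExpMoment μ κ := by
  have := hμ.isProbability
  obtain ⟨R, hR, hR'⟩ := exists_lt_measureReal_ball μ (c := 3 / 4) (by norm_num)
  -- With this κ, exp(κ‖u‖) doubles when ‖u‖ grows by 2R, while the tail bound drops by a factor 3;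
  -- the resulting series has ratio 2/3.
  refine ⟨Real.log 2 / (2 * R), div_pos (Real.log_pos (by norm_num)) (by positivity),
    by fun_prop, ?_⟩
  set κ := Real.log 2 / (2 * R) with hκ
  have hκ0 : 0 < κ := div_pos (Real.log_pos (by norm_num)) (by positivity)
  let A : ℕ → Set X := fun n => {u : X | (2 * (n : ℝ) - 1) * R ≤ ‖u‖}
  have hAm : ∀ n, MeasurableSet (A n) := fun n =>
    measurableSet_le measurable_const measurable_norm
  have hbound : ∀ u : X, ‖Real.exp (κ * ‖u‖)‖ₑ ≤
      ∑' n : ℕ, (A n).indicator (fun _ => ENNReal.ofReal (2 ^ (n + 1))) u := by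
    intro u
    set n := ⌊‖u‖ / (2 * R)⌋₊ with hn
    have hn1 : n * (2 * R) ≤ ‖u‖ := by
      rw [← le_div_iff₀ (by positivity)]; exact Nat.floor_le (by positivity)
    have hn2 : ‖u‖ ≤ (n + 1) * (2 * R) := by
      rw [← div_le_iff₀ (by positivity)]; exact (Nat.lt_floor_add_one _).le
    refine le_trans ?_ (ENNReal.le_tsum n)
    rw [indicator_of_mem (show u ∈ A n by simp only [A, mem_ofPred_eq]; nlinarith),
      Real.enorm_of_nonneg (Real.exp_pos _).le]
    refine ENNReal.ofReal_le_ofReal ?_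
    calc Real.exp (κ * ‖u‖) ≤ Real.exp (κ * ((n + 1) * (2 * R))) := by gcongr
      _ = Real.exp (((n + 1 : ℕ) : ℝ) * Real.log 2) := by
          rw [hκ]; congr 1; push_cast; field_simp
      _ = 2 ^ (n + 1) := by rw [Real.exp_nat_mul, Real.exp_log (by norm_num)]
  refine (lintegral_mono hbound).trans_lt ?_
  rw [lintegral_tsum fun n => (measurable_const.indicator (hAm n)).aemeasurable]
  have hterm : ∀ n, ∫⁻ u, (A n).indicator (fun _ => ENNReal.ofReal (2 ^ (n + 1))) u ∂μ ≤
      ENNReal.ofReal (2 * (2 / 3) ^ n) := by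
    intro n
    rw [lintegral_indicator_const (hAm n), ← ofReal_measureReal,
      ← ENNReal.ofReal_mul (by positivity)]
    refine ENNReal.ofReal_le_ofReal ?_
    calc (2 : ℝ) ^ (n + 1) * μ.real (A n) ≤ 2 ^ (n + 1) * (1 / 3) ^ n := by
          gcongr; exact hμ.measureReal_tail_le hR' n
      _ = 2 * (2 / 3) ^ n := by rw [pow_succ, mul_assoc, mul_comm 2, ← mul_assoc, ← mul_pow]; ring
  refine (ENNReal.tsum_le_tsum hterm).trans_lt ?_
  rw [← ENNReal.ofReal_tsum_of_nonneg (fun n => by positivity)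
    ((summable_geometric_of_lt_one (by norm_num) (by norm_num)).mul_left 2)]
  exact ENNReal.ofReal_lt_top

end ExpMoment

/-! ### Hellinger distance and L¹ estimates -/

section Hellinger

variable {X : Type*} [MeasurableSpace X]

/-- The squared Hellinger distance is bounded by the total variation distance, computed with any
dominating measure. -/
theorem hellingerDist_sq_le {μ ν₁ ν₂ : Measure X} [IsFiniteMeasure μ] [IsFiniteMeasure ν₁]
    [IsFiniteMeasure ν₂] (h₁ : ν₁ ≪ μ) (h₂ : ν₂ ≪ μ) :
    hellingerDist ν₁ ν₂ ^ 2 ≤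
      1 / 2 * ∫ u, |(ν₁.rnDeriv μ u).toReal - (ν₂.rnDeriv μ u).toReal| ∂μ := by
  have hint : 0 ≤ ∫ u, (Real.sqrt (ν₁.rnDeriv (ν₁ + ν₂) u).toReal
    - Real.sqrt (ν₂.rnDeriv (ν₁ + ν₂) u).toReal) ^ 2 ∂(ν₁ + ν₂) :=
    integral_nonneg fun u => sq_nonneg _
  rw [hellingerDist, Real.sq_sqrt (by positivity)]
  gcongr
  have hac : ν₁ + ν₂ ≪ μ := h₁.add_left h₂
  rw [← integral_toReal_rnDeriv_mul hac]
  have e₁ : ν₁.rnDeriv (ν₁ + ν₂) * (ν₁ + ν₂).rnDeriv μ =ᵐ[μ] ν₁.rnDeriv μ :=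
    Measure.rnDeriv_mul_rnDeriv (Measure.AbsolutelyContinuous.rfl.add_right _)
  have e₂ : ν₂.rnDeriv (ν₁ + ν₂) * (ν₁ + ν₂).rnDeriv μ =ᵐ[μ] ν₂.rnDeriv μ :=
    Measure.rnDeriv_mul_rnDeriv (Measure.AbsolutelyContinuous.rfl.add_right' _)
  refine integral_mono_of_nonneg (ae_of_all _ fun u => by positivity)
    (Measure.integrable_toReal_rnDeriv.sub Measure.integrable_toReal_rnDeriv).abs ?_
  filter_upwards [e₁, e₂] with u hu₁ hu₂
  rw [← hu₁, ← hu₂, Pi.mul_apply, Pi.mul_apply, ENNReal.toReal_mul, ENNReal.toReal_mul, ← sub_mul,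
    abs_mul, abs_of_nonneg (ENNReal.toReal_nonneg (a := (ν₁ + ν₂).rnDeriv μ u)),
    mul_comm _ ((ν₁ + ν₂).rnDeriv μ u).toReal]
  gcongr
  set a := (ν₁.rnDeriv (ν₁ + ν₂) u).toReal
  set b := (ν₂.rnDeriv (ν₁ + ν₂) u).toReal
  have ha : 0 ≤ a := ENNReal.toReal_nonneg
  have hb : 0 ≤ b := ENNReal.toReal_nonneg
  -- The claim (√a - √b)² ≤ |a - b| reduces to |√a - √b| ≤ √a + √b.
  have hfac : a - b = (√a - √b) * (√a + √b) := by
    nlinarith [Real.sq_sqrt ha, Real.sq_sqrt hb]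
  rw [hfac, abs_mul, abs_of_nonneg (by positivity : 0 ≤ √a + √b), ← sq_abs, sq]
  gcongr
  rw [abs_le]
  constructor <;> linarith [Real.sqrt_nonneg a, Real.sqrt_nonneg b]

/-- Normalization is Lipschitz in `L¹`. -/
theorem integral_abs_normalized_sub_le {μ : Measure X} {f g : X → ℝ} (hf : Integrable f μ)
    (hg : Integrable g μ) (hg0 : ∀ u, 0 ≤ g u) (hf' : 0 < ∫ u, f u ∂μ) (hg' : 0 < ∫ u, g u ∂μ) :
    ∫ u, |(∫ v, f v ∂μ)⁻¹ * f u - (∫ v, g v ∂μ)⁻¹ * g u| ∂μ ≤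
      2 * (∫ u, f u ∂μ)⁻¹ * ∫ u, |f u - g u| ∂μ := by
  set a := ∫ u, f u ∂μ
  set b := ∫ u, g u ∂μ
  have hab : |a - b| ≤ ∫ u, |f u - g u| ∂μ := by
    rw [← integral_sub hf hg]; exact abs_integral_le_integral_abs
  have hfg : Integrable (fun u => |f u - g u|) μ := (hf.sub hg).abs
  calc ∫ u, |a⁻¹ * f u - b⁻¹ * g u| ∂μ
      ≤ ∫ u, (a⁻¹ * |f u - g u| + |a⁻¹ - b⁻¹| * g u) ∂μ := by
        refine integral_mono (((hf.const_mul _).sub (hg.const_mul _)).abs)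
          ((hfg.const_mul _).add (hg.const_mul _)) fun u => ?_
        have : a⁻¹ * f u - b⁻¹ * g u = a⁻¹ * (f u - g u) + (a⁻¹ - b⁻¹) * g u := by ring
        simp only
        rw [this]
        refine (abs_add_le _ _).trans (le_of_eq ?_)
        rw [abs_mul, abs_mul, abs_of_pos (inv_pos.2 hf'), abs_of_nonneg (hg0 u)]
    _ = a⁻¹ * ∫ u, |f u - g u| ∂μ + |a⁻¹ - b⁻¹| * b := by
        rw [integral_add (hfg.const_mul _) (hg.const_mul _), integral_const_mul,
          integral_const_mul]
    _ = a⁻¹ * ∫ u, |f u - g u| ∂μ + a⁻¹ * |a - b| := by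
        -- The factor b cancels, so only a needs a quantitative lower bound.
        have : a⁻¹ - b⁻¹ = - (a⁻¹ * (a - b) * b⁻¹) := by field_simp; ring
        rw [this, abs_neg, abs_mul, abs_mul, abs_of_pos (inv_pos.2 hf'), abs_of_pos (inv_pos.2 hg'),
          inv_mul_cancel_right₀ hg'.ne']
    _ ≤ 2 * a⁻¹ * ∫ u, |f u - g u| ∂μ := by
        have := mul_le_mul_of_nonneg_left hab (inv_pos.2 hf').le
        linarith

/-- The slope of exp(-x) on [m, ∞) is at most exp(-m) in absolute value; the proof uses 1 + x ≤ exp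
x. -/
theorem abs_exp_neg_sub_exp_neg_le {a b m : ℝ} (ha : m ≤ a) (hb : m ≤ b) :
    |Real.exp (-a) - Real.exp (-b)| ≤ Real.exp (-m) * |a - b| := by
  wlog hab : a ≤ b generalizing a b
  · rw [abs_sub_comm, abs_sub_comm a]; exact this hb ha (le_of_not_ge hab)
  have h1 : Real.exp (-b) ≤ Real.exp (-a) := by gcongr
  rw [abs_of_nonneg (by linarith), abs_of_nonpos (by linarith)]
  have h2 : Real.exp (-b) = Real.exp (-a) * Real.exp (a - b) := by
    rw [← Real.exp_add]; congr 1; ring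
  have h3 : Real.exp (-a) ≤ Real.exp (-m) := by gcongr
  have h4 := Real.add_one_le_exp (a - b)
  calc Real.exp (-a) - Real.exp (-b) = Real.exp (-a) * (1 - Real.exp (a - b)) := by rw [h2]; ring
    _ ≤ Real.exp (-a) * -(a - b) := by gcongr; linarith
    _ ≤ Real.exp (-m) * -(a - b) := by gcongr; linarith

end Hellinger

/-! ### Posteriors: existence, stability, consistency -/

/-- The potential is continuous in the unknown. -/
theorem LikelihoodAssumption.continuous {X Y : Type*} [NormedAddCommGroup X]
    [NormedAddCommGroup Y] {Φ : X → Y → ℝ} {α₁ α₂ : ℝ}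
    (h : LikelihoodAssumption Φ α₁ α₂) (y : Y) : Continuous fun u => Φ u y := by
  rw [continuous_iff_continuousAt]
  intro u
  have hr : 0 < ‖u‖ + ‖y‖ + 1 := by positivity
  obtain ⟨L, -, hL⟩ := h.continuity_u _ hr
  have hlip : LipschitzOnWith L.toNNReal (fun u => Φ u y) (Metric.ball 0 (‖u‖ + ‖y‖ + 1)) := by
    refine LipschitzOnWith.of_dist_le_mul fun v hv w hw => ?_
    rw [Real.dist_eq, dist_eq_norm]
    refine (hL v w y ?_).trans (by gcongr; exact Real.le_coe_toNNReal L)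
    exact max_lt (max_lt (by simpa using hv) (by simpa using hw)) (by linarith [norm_nonneg u])
  exact hlip.continuousOn.continuousAt (Metric.isOpen_ball.mem_nhds
    (by simp only [mem_ball_zero_iff]; linarith [norm_nonneg y]))

section Posterior

variable {X Y : Type*} [NormedAddCommGroup X] [MeasurableSpace X] [BorelSpace X]

theorem HasExpMoment.mono {μ : Measure X} {κ α : ℝ} (h : HasExpMoment μ κ) (hα : α ≤ κ) :
    Integrable (fun u => Real.exp (α * ‖u‖)) μ := by
  refine Integrable.mono' h (by fun_prop) (ae_of_all _ fun u => ?_)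
  rw [Real.norm_of_nonneg (Real.exp_pos _).le]
  gcongr

/-- `exp (-φ)` is integrable if `φ` is bounded below by a multiple of the norm. -/
theorem HasExpMoment.integrable_exp_neg {μ : Measure X} {κ α M : ℝ} (h : HasExpMoment μ κ)
    (hα : α ≤ κ) {φ : X → ℝ} (hφ : AEMeasurable φ μ) (hM : ∀ u, M - α * ‖u‖ ≤ φ u) :
    Integrable (fun u => Real.exp (-φ u)) μ := by
  refine Integrable.mono' ((h.mono hα).const_mul (Real.exp (-M)))
    hφ.neg.exp.aestronglyMeasurable (ae_of_all _ fun u => ?_)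
  rw [Real.norm_of_nonneg (Real.exp_pos _).le, ← Real.exp_add]
  gcongr
  linarith [hM u]

theorem IsPosterior.eq_withDensity {Z : Type*} {mX : MeasurableSpace Z} {μ ν : Measure Z}
    [IsFiniteMeasure μ] {Φ : Z → Y → ℝ} {y : Y} (h : IsPosterior μ Φ y ν) :
    ν = μ.withDensity fun u => ENNReal.ofReal ((normalizer μ Φ y)⁻¹ * Real.exp (-Φ u y)) := by
  have := h.isProbability
  rw [← withDensity_congr_ae h.bayes_rule, Measure.withDensity_rnDeriv_eq _ _ h.absolutelyContinuous]

/-- Bayes' rule defines a unique posterior as soon as the likelihood is integrable. -/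
theorem existsUnique_isPosterior {Z : Type*} {mX : MeasurableSpace Z} {μ : Measure Z}
    [IsProbabilityMeasure μ] {Φ : Z → Y → ℝ} {y : Y}
    (hi : Integrable (fun u => Real.exp (-Φ u y)) μ) : ∃! ν, IsPosterior μ Φ y ν := by
  have hpos : 0 < normalizer μ Φ y := integral_exp_pos hi
  refine ⟨μ.withDensity fun u => ENNReal.ofReal ((normalizer μ Φ y)⁻¹ * Real.exp (-Φ u y)),
    ⟨⟨?_⟩, withDensity_absolutelyContinuous _ _, hi, hpos, ?_⟩, fun ν hν => hν.eq_withDensity⟩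
  · rw [withDensity_apply _ MeasurableSet.univ, Measure.restrict_univ,
      ← ofReal_integral_eq_lintegral_ofReal (hi.const_mul _)
        (ae_of_all _ fun u => by positivity), integral_const_mul]
    change ENNReal.ofReal ((normalizer μ Φ y)⁻¹ * normalizer μ Φ y) = 1
    rw [inv_mul_cancel₀ hpos.ne', ENNReal.ofReal_one]
  -- The a.e.-measurable version is needed because the approximate potentials are only a.e.
  -- measurable.
  · exact Measure.rnDeriv_withDensity₀ μ (hi.const_mul _).aemeasurable.ennreal_ofReal

/-- The normalizing constant is bounded below in terms of an upper bound on a ball. -/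
theorem le_normalizer {μ : Measure X} [IsProbabilityMeasure μ] {Φ : X → Y → ℝ} {y : Y}
    (hi : Integrable (fun u => Real.exp (-Φ u y)) μ) {K R : ℝ} (hK : ∀ u, ‖u‖ < R → Φ u y ≤ K) :
    Real.exp (-K) * μ.real (Metric.ball 0 R) ≤ normalizer μ Φ y := by
  have hB : MeasurableSet (Metric.ball (0 : X) R) := Metric.isOpen_ball.measurableSet
  calc Real.exp (-K) * μ.real (Metric.ball 0 R) = ∫ _ in Metric.ball (0 : X) R, Real.exp (-K) ∂μ := by
        rw [setIntegral_const, smul_eq_mul, mul_comm]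
    _ ≤ ∫ u in Metric.ball (0 : X) R, Real.exp (-Φ u y) ∂μ := by
        refine setIntegral_mono_on (integrable_const _).integrableOn hi.integrableOn hB fun u hu => ?_
        have := hK u (by simpa using hu)
        gcongr
    _ ≤ normalizer μ Φ y :=
        setIntegral_le_integral hi (ae_of_all _ fun u => (Real.exp_pos _).le)

/-- Stability estimate for the posterior under a perturbation of the potential. -/
theorem IsPosterior.hellingerDist_sq_le {Y' : Type*} {μ ν ν' : Measure X} [IsProbabilityMeasure μ]
    {Φ : X → Y → ℝ} {Φ' : X → Y' → ℝ} {y : Y} {y' : Y'} (hν : IsPosterior μ Φ y ν)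
    (hν' : IsPosterior μ Φ' y' ν') {κ α₁ α M K R C δ : ℝ} (hκ : HasExpMoment μ κ)
    (hα : α₁ + α ≤ κ) (hM : ∀ u, M - α₁ * ‖u‖ ≤ Φ u y) (hM' : ∀ u, M - α₁ * ‖u‖ ≤ Φ' u y')
    (hR : 0 < μ.real (Metric.ball 0 R)) (hK : ∀ u, ‖u‖ < R → Φ u y ≤ K)
    (hδ : ∀ u, |Φ u y - Φ' u y'| ≤ Real.exp (α * ‖u‖ + C) * δ) :
    hellingerDist ν ν' ^ 2 ≤ (Real.exp (-K) * μ.real (Metric.ball 0 R))⁻¹ *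
      (Real.exp (C - M) * ∫ u, Real.exp ((α₁ + α) * ‖u‖) ∂μ) * δ := by
  have := hν.isProbability
  have := hν'.isProbability
  have hz := le_normalizer hν.integrable hK
  have hdiff : ∫ u, |Real.exp (-Φ u y) - Real.exp (-Φ' u y')| ∂μ ≤
      (Real.exp (C - M) * ∫ u, Real.exp ((α₁ + α) * ‖u‖) ∂μ) * δ := by
    rw [← integral_const_mul, ← integral_mul_const]
    refine integral_mono (hν.integrable.sub hν'.integrable).abs
      (((hκ.mono hα).const_mul _).mul_const _) fun u => ?_
    refine (abs_exp_neg_sub_exp_neg_le (hM u) (hM' u)).trans ?_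
    calc Real.exp (-(M - α₁ * ‖u‖)) * |Φ u y - Φ' u y'|
        ≤ Real.exp (-(M - α₁ * ‖u‖)) * (Real.exp (α * ‖u‖ + C) * δ) := by gcongr; exact hδ u
      _ = Real.exp (C - M) * Real.exp ((α₁ + α) * ‖u‖) * δ := by
        rw [← mul_assoc, ← Real.exp_add, ← Real.exp_add]; congr 2; ring
  have hTV : ∫ u, |(ν.rnDeriv μ u).toReal - (ν'.rnDeriv μ u).toReal| ∂μ =
      ∫ u, |(normalizer μ Φ y)⁻¹ * Real.exp (-Φ u y) -
        (normalizer μ Φ' y')⁻¹ * Real.exp (-Φ' u y')| ∂μ := by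
    refine integral_congr_ae ?_
    have p := hν.normalizer_pos
    have p' := hν'.normalizer_pos
    filter_upwards [hν.bayes_rule, hν'.bayes_rule] with u hu hu'
    rw [hu, hu', ENNReal.toReal_ofReal (by positivity), ENNReal.toReal_ofReal (by positivity)]
  have hpos : 0 < Real.exp (-K) * μ.real (Metric.ball 0 R) := by positivity
  have hL1 : 0 ≤ ∫ u, |Real.exp (-Φ u y) - Real.exp (-Φ' u y')| ∂μ :=
    integral_nonneg fun u => abs_nonneg _
  calc hellingerDist ν ν' ^ 2 ≤ _ :=
        BayesInverse.hellingerDist_sq_le hν.absolutelyContinuous hν'.absolutelyContinuous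
    _ ≤ 1 / 2 * (2 * (normalizer μ Φ y)⁻¹ *
          ∫ u, |Real.exp (-Φ u y) - Real.exp (-Φ' u y')| ∂μ) := by
        rw [hTV]
        exact mul_le_mul_of_nonneg_left (integral_abs_normalized_sub_le hν.integrable
          hν'.integrable (fun u => (Real.exp_pos _).le) hν.normalizer_pos hν'.normalizer_pos)
          (by norm_num)
    _ = (normalizer μ Φ y)⁻¹ * ∫ u, |Real.exp (-Φ u y) - Real.exp (-Φ' u y')| ∂μ := by ring
    _ ≤ (Real.exp (-K) * μ.real (Metric.ball 0 R))⁻¹ *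
          ∫ u, |Real.exp (-Φ u y) - Real.exp (-Φ' u y')| ∂μ := by gcongr
    _ ≤ _ := by rw [mul_assoc]; gcongr

variable [NormedAddCommGroup Y]

theorem LikelihoodAssumption.integrable_exp_neg {μ : Measure X} {Φ : X → Y → ℝ} {α₁ α₂ κ : ℝ}
    (h : LikelihoodAssumption Φ α₁ α₂) (hκ : HasExpMoment μ κ) (hα : α₁ ≤ κ) (y : Y) :
    Integrable (fun u => Real.exp (-Φ u y)) μ := by
  obtain ⟨M, hM⟩ := h.lower_bound (‖y‖ + 1) (by positivity)
  exact hκ.integrable_exp_neg hα (h.continuous y).aemeasurable fun u => hM u y (by linarith)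

/-- Existence, uniqueness and Hellinger stability of the posterior. -/
theorem LikelihoodAssumption.isWellPosed {μ : Measure X} [IsProbabilityMeasure μ] {Φ : X → Y → ℝ}
    {α₁ α₂ κ : ℝ} (h : LikelihoodAssumption Φ α₁ α₂) (hκ : HasExpMoment μ κ) (hα₂ : 0 ≤ α₂)
    (hα : α₁ + α₂ ≤ κ) : IsWellPosed μ Φ := by
  refine ⟨fun y => existsUnique_isPosterior (h.integrable_exp_neg hκ (by linarith) y),
    fun r hr ε hε => ?_⟩
  obtain ⟨R, hR, hR'⟩ := exists_lt_measureReal_ball μ (c := 0) (by norm_num)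
  obtain ⟨M, hM⟩ := h.lower_bound r hr
  -- One radius covers both the unknowns in the ball of radius R and the data of norm below r, so K
  -- is uniform in the data.
  obtain ⟨K, -, hK⟩ := h.bounded_above (max R r) (lt_max_of_lt_left hR)
  obtain ⟨C, hC⟩ := h.continuity_y r hr
  set D := (Real.exp (-K) * μ.real (Metric.ball 0 R))⁻¹ *
    (Real.exp (C - M) * ∫ u, Real.exp ((α₁ + α₂) * ‖u‖) ∂μ) with hD
  have hD0 : 0 ≤ D := by
    have : 0 ≤ ∫ u, Real.exp ((α₁ + α₂) * ‖u‖) ∂μ := integral_nonneg fun u => (Real.exp_pos _).le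
    positivity
  -- The squared distance is at most D‖y - y'‖; D + 1 replaces D because only D ≥ 0 is known.
  refine ⟨ε ^ 2 / (D + 1), by positivity, fun y y' hy hy' hyy ν ν' hν hν' => ?_⟩
  have key := hν.hellingerDist_sq_le hν' hκ hα (fun u => hM u y hy) (fun u => hM u y' hy') hR'
    (fun u hu => hK u y (max_lt (lt_max_of_lt_left hu) (lt_max_of_lt_right hy)))
    (fun u => hC y y' (max_lt hy hy') u)
  refine lt_of_pow_lt_pow_left₀ 2 hε.le (key.trans_lt ?_)
  have hnn := norm_nonneg (y - y')
  rw [lt_div_iff₀ (by positivity)] at hyy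
  nlinarith

/-- Convergence of the approximate posteriors in the Hellinger distance. -/
theorem LikelihoodAssumption.isConsistentApproximation {μ : Measure X} [IsProbabilityMeasure μ]
    {Φ : X → Y → ℝ} {ΦN : ℕ → X → Y → ℝ} {α₁ α₂ α₃ κ : ℝ} {y : Y}
    (h : LikelihoodAssumption Φ α₁ α₂) (hN : ApproximationAssumption μ Φ ΦN y α₁ α₃)
    (hκ : HasExpMoment μ κ) (hα₃ : 0 ≤ α₃) (hα : α₁ + α₃ ≤ κ) :
    IsConsistentApproximation μ Φ ΦN y := by
  have hr : 0 < ‖y‖ + 1 := by positivity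
  have hy : ‖y‖ < ‖y‖ + 1 := by linarith
  obtain ⟨M, hM⟩ := h.lower_bound _ hr
  obtain ⟨M', hM'⟩ := hN.lower_bound _ hr
  refine ⟨existsUnique_isPosterior (h.integrable_exp_neg hκ (by linarith) y), fun N =>
    existsUnique_isPosterior (hκ.integrable_exp_neg (by linarith) (hN.aemeasurable N)
      fun u => hM' N u y hy), fun ν νN hν hνN => ?_⟩
  obtain ⟨R, hR, hR'⟩ := exists_lt_measureReal_ball μ (c := 0) (by norm_num)
  obtain ⟨K, -, hK⟩ := h.bounded_above (max R (‖y‖ + 1)) (lt_max_of_lt_left hR)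
  obtain ⟨C, ψ, hψ, hC⟩ := hN.approx
  have key := fun N => hν.hellingerDist_sq_le (hνN N) hκ hα
    -- The common lower constant is min M M', independent of N.
    (fun u => (sub_le_sub_right (min_le_left M M') _).trans (hM u y hy))
    (fun u => (sub_le_sub_right (min_le_right M M') _).trans (hM' N u y hy)) hR'
    (fun u hu => hK u y (max_lt (lt_max_of_lt_left hu) (lt_max_of_lt_right hy))) (hC N)
  have hsq : Tendsto (fun N => hellingerDist ν (νN N) ^ 2) atTop (𝓝 0) :=
    squeeze_zero (fun N => sq_nonneg _) key (by simpa using hψ.const_mul _)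
  have hsqrt := (Real.continuous_sqrt.tendsto 0).comp hsq
  rw [Real.sqrt_zero] at hsqrt
  refine hsqrt.congr fun N => ?_
  exact Real.sqrt_sq (Real.sqrt_nonneg _)

end Posterior

end BayesInverse

theorem mainTheorem1 {X Y : Type*}
    [NormedAddCommGroup X] [NormedSpace ℝ X] [CompleteSpace X]
    [MeasurableSpace X] [BorelSpace X]
    [NormedAddCommGroup Y] [NormedSpace ℝ Y] [CompleteSpace Y]
    (μ₀ : Measure X) (hμ₀ : BayesInverse.IsConvexProbabilityMeasure μ₀)
    (Φ : X → Y → ℝ) (α₁ α₂ : ℝ) (hα₁ : 0 ≤ α₁) (hα₂ : 0 ≤ α₂)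
    (hΦ : BayesInverse.LikelihoodAssumption Φ α₁ α₂) :
    (∃ κ : ℝ, 0 < κ ∧ BayesInverse.HasExpMoment μ₀ κ) ∧
    ∀ κ : ℝ, 0 < κ → BayesInverse.HasExpMoment μ₀ κ → α₁ + 2 * α₂ ≤ κ →
      BayesInverse.IsWellPosed μ₀ Φ ∧
      (∀ (y : Y) (ΦN : ℕ → X → Y → ℝ) (α₃ : ℝ), 0 ≤ α₃ →
        BayesInverse.ApproximationAssumption μ₀ Φ ΦN y α₁ α₃ → α₁ + 2 * α₃ ≤ κ →
        BayesInverse.IsConsistentApproximation μ₀ Φ ΦN y) ∧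
      (∀ y : Y, ConvexOn ℝ Set.univ (fun u => Φ u y) →
        ∀ ν : Measure X, BayesInverse.IsPosterior μ₀ Φ y ν →
          BayesInverse.IsConvexProbabilityMeasure ν) := by

  have := hμ₀.isProbability
  refine ⟨hμ₀.exists_hasExpMoment, fun κ _ hκ hle => ⟨hΦ.isWellPosed hκ hα₂ (by linarith),
    fun y ΦN α₃ hα₃ hN hle₃ => hΦ.isConsistentApproximation hN hκ hα₃ (by linarith),
    fun y hc ν hν => ?_⟩⟩
  exact hμ₀.of_withDensity hν.isProbability (hΦ.continuous y) hc
    (inv_nonneg.2 hν.normalizer_pos.le) hν.eq_withDensity
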